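/- Let $X$ be a real or complex Hilbert space and let $M,N$ be closed subspaces of $X$. For Hilbert spaces $H_1,H_2$ (over the same field) $H_1\oplus H_2$ denotes their Hilbert space direct sum, and $\mathrm{Gr}(A)=\{(x,Ax): x\in D(A)\}\subseteq H_1\oplus H_2$ denotes the graph of a linear operator $A:D(A)\to H_2$ with $D(A)\subseteq H_1$. Unordered pairs $\{M,N\}$ of subspaces of $X$ and $\{M',N'\}$ of subspaces of $X'$ are called unitarily equivalent if there is a linear isometry $U$ of $X$ onto $X'$ with $\{U(M),U(N)\}=\{M',N'\}$. A contraction is a bounded linear operator of norm at most $1$, and $\dim$ denotes the Hilbert dimension, i.e. the cardinality of an orthonormal basis. Then the following hold. 1. The following are equivalent: (a) $\{M,N\}$ is in position $p'$, i.e. $M\cap N^{\perp}=M^{\perp}\cap N=\{0\}$. (b) There exist Hilbert spaces $X_1,X_2$ and a contraction $T:X_1\to X_2$ with $I-T^*T$ injective such that $\{M,N\}$ is unitarily equivalent to $\{\mathrm{Gr}(-T),\mathrm{Gr}(T)\}$. (c) There exist Hilbert spaces $Y_1,Y_2$ and a densely defined closed linear operator $S:D(S)\to Y_2$, $D(S)\subseteq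 Y_1$, such that $\{M,N\}$ is unitarily equivalent to $\{Y_1\oplus\{0\},\mathrm{Gr}(S)\}$. 2. The following are equivalent: (a) $\{M,N\}$ is equivalently positioned, i.e. $\dim(M\cap N^{\perp})=\dim(M^{\perp}\cap N)$. (b) There exist Hilbert spaces $X_1,X_2$ and a contraction $T:X_1\to X_2$ such that $\{M,N\}$ is unitarily equivalent to $\{\mathrm{Gr}(-T),\mathrm{Gr}(T)\}$. -/

import Mathlib

universe u

/-- The Hilbert dimension of a Hilbert space `E`: the cardinality of an orthonormal (Hilbert) basis
of `E`. All orthonormal bases have the same cardinality (see `hilbertDim_eq_mk`); we take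
the least one. This differs from the algebraic dimension `Module.rank` in infinite dimensions. -/
noncomputable def hilbertDim (𝕜 : Type*) [RCLike 𝕜] (E : Type u) [NormedAddCommGroup E]
    [InnerProductSpace 𝕜 E] : Cardinal.{u} :=
  sInf {c : Cardinal.{u} | ∃ ι : Type u, Nonempty (HilbertBasis ι 𝕜 E) ∧ Cardinal.mk ι = c}

/-- One half of the invariance of the cardinality of an orthonormal basis. -/
theorem HilbertBasis.mk_le_mk {𝕜 : Type*} [RCLike 𝕜] {E : Type u} [NormedAddCommGroup E]
    [InnerProductSpace 𝕜 E] {ι κ : Type u} (b : HilbertBasis ι 𝕜 E) (c : HilbertBasis κ 𝕜 E) :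
    Cardinal.mk ι ≤ Cardinal.mk κ := by
  classical
  rcases finite_or_infinite κ with hκ | hκ
  · have := Fintype.ofFinite κ
    have hfin : FiniteDimensional 𝕜 E := by
      have := c.toOrthonormalBasis.toBasis
      exact Module.Basis.finiteDimensional_of_finite this
    have h1 := b.orthonormal.linearIndependent.cardinal_le_rank
    have h2 := c.toOrthonormalBasis.toBasis.mk_eq_rank''
    rw [h2]
    exact h1
  · -- every basis vector of `c` is orthogonal to all but countably many vectors of `b`
    have hcount : ∀ k : κ, {i : ι | inner 𝕜 (b i) (c k) ≠ 0}.Countable := by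
      intro k
      have hs := (b.orthonormal.inner_products_summable (x := c k)).countable_support
      refine hs.mono ?_
      intro i hi
      simpa using hi
    have hcover : (⋃ k : κ, {i : ι | inner 𝕜 (b i) (c k) ≠ 0}) = Set.univ := by
      refine Set.eq_univ_of_forall fun i => ?_
      by_contra hcon
      simp only [Set.mem_iUnion, Set.mem_ofPred_eq, not_exists, not_not] at hcon
      have hz : b i = 0 := by
        apply c.repr.injective
        ext k
        rw [c.repr_apply_apply, inner_eq_zero_symm.mp (hcon k)]
        simp
      have := b.orthonormal.1 i
      rw [hz, norm_zero] at this
      exact zero_ne_one this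
    calc Cardinal.mk ι = Cardinal.mk (Set.univ : Set ι) := Cardinal.mk_univ.symm
      _ = Cardinal.mk (⋃ k : κ, {i : ι | inner 𝕜 (b i) (c k) ≠ 0} : Set ι) := by rw [hcover]
      _ ≤ Cardinal.mk κ * ⨆ k : κ, Cardinal.mk {i : ι | inner 𝕜 (b i) (c k) ≠ 0} :=
          Cardinal.mk_iUnion_le _
      _ ≤ Cardinal.mk κ * Cardinal.aleph0 := by
          gcongr
          exact ciSup_le' fun k => (hcount k).le_aleph0
      _ = Cardinal.mk κ := Cardinal.mul_aleph0_eq (Cardinal.aleph0_le_mk κ)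

/-- The Hilbert dimension is the cardinality of any orthonormal basis. -/
theorem hilbertDim_eq_mk {𝕜 : Type*} [RCLike 𝕜] {E : Type u} [NormedAddCommGroup E]
    [InnerProductSpace 𝕜 E] {ι : Type u} (b : HilbertBasis ι 𝕜 E) :
    hilbertDim 𝕜 E = Cardinal.mk ι := by
  refine le_antisymm (csInf_le' ⟨ι, ⟨b⟩, rfl⟩) (le_csInf ⟨_, ι, ⟨b⟩, rfl⟩ ?_)
  rintro _ ⟨κ, ⟨c⟩, rfl⟩
  exact b.mk_le_mk c

/-- The pair of subspaces `M`, `N` is in position `p'`: `M ∩ Nᗮ = Mᗮ ∩ N = {0}`. -/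
def InPositionPPrime {𝕜 : Type*} [RCLike 𝕜] {X : Type*} [NormedAddCommGroup X]
    [InnerProductSpace 𝕜 X] (M N : Submodule 𝕜 X) : Prop :=
  M ⊓ Nᗮ = ⊥ ∧ Mᗮ ⊓ N = ⊥

/-- The pair of subspaces `M`, `N` is equivalently positioned: `dim (M ∩ Nᗮ) = dim (Mᗮ ∩ N)`,
for the Hilbert dimension. -/
def EquivalentlyPositioned {𝕜 : Type*} [RCLike 𝕜] {X : Type u} [NormedAddCommGroup X]
    [InnerProductSpace 𝕜 X] (M N : Submodule 𝕜 X) : Prop :=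
  hilbertDim 𝕜 ↥(M ⊓ Nᗮ) = hilbertDim 𝕜 ↥(Mᗮ ⊓ N)

/-- Unitary equivalence of the unordered pairs `{M, N}` and `{M', N'}`: some isometric
isomorphism of `X` onto `X'` takes the one pair to the other. -/
def UnitarilyEquivalentPairs {𝕜 : Type*} [RCLike 𝕜] {X X' : Type*}
    [NormedAddCommGroup X] [InnerProductSpace 𝕜 X]
    [NormedAddCommGroup X'] [InnerProductSpace 𝕜 X']
    (M N : Submodule 𝕜 X) (M' N' : Submodule 𝕜 X') : Prop :=
  ∃ U : X ≃ₗᵢ[𝕜] X',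
    (M.map U.toLinearEquiv.toLinearMap = M' ∧ N.map U.toLinearEquiv.toLinearMap = N') ∨
    (M.map U.toLinearEquiv.toLinearMap = N' ∧ N.map U.toLinearEquiv.toLinearMap = M')

/-- A subspace of the vector space `E × F`, seen as a subspace of the Hilbert space direct sum
`E ⊕ F`, i.e. of `WithLp 2 (E × F)`. -/
def Submodule.inHilbertSum {𝕜 : Type*} [RCLike 𝕜] {E F : Type*}
    [NormedAddCommGroup E] [InnerProductSpace 𝕜 E]
    [NormedAddCommGroup F] [InnerProductSpace 𝕜 F] (p : Submodule 𝕜 (E × F)) :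
    Submodule 𝕜 (WithLp 2 (E × F)) :=
  p.comap (WithLp.linearEquiv 2 𝕜 (E × F)).toLinearMap

/-- The graph of a bounded operator `T : E → F`, as a subspace of the Hilbert space `E ⊕ F`. -/
def ContinuousLinearMap.hilbertGraph {𝕜 : Type*} [RCLike 𝕜] {E F : Type*}
    [NormedAddCommGroup E] [InnerProductSpace 𝕜 E]
    [NormedAddCommGroup F] [InnerProductSpace 𝕜 F] (T : E →L[𝕜] F) :
    Submodule 𝕜 (WithLp 2 (E × F)) :=
  T.toLinearMap.graph.inHilbertSum

/-- The graph of an operator `S : D(S) → F`, `D(S) ⊆ E`, as a subspace of the Hilbert space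
`E ⊕ F`. -/
def LinearPMap.hilbertGraph {𝕜 : Type*} [RCLike 𝕜] {E F : Type*}
    [NormedAddCommGroup E] [InnerProductSpace 𝕜 E]
    [NormedAddCommGroup F] [InnerProductSpace 𝕜 F] (S : E →ₗ.[𝕜] F) :
    Submodule 𝕜 (WithLp 2 (E × F)) :=
  S.graph.inHilbertSum

/-! Let `B : M → N` be the restriction to `M` of the orthogonal projection onto `N`. Its kernel is
`M ⊓ Nᗮ` and that of its adjoint is `Mᗮ ⊓ N`, so equality of their dimensions is what allows
the polar decomposition `B = W S` to have a *unitary* factor `W : M → N`. Since `S` is positive,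
`⟪W x, y⟫ = ⟪x, W y⟫` and `0 ≤ re ⟪W x, x⟫` for `x y : M`. Consequently `W x + x ⟂ W y - y` and
`‖W x - x‖ ≤ ‖W x + x‖`, so that `W x + x ↦ W x - x` is a contraction `T : K → Kᗮ`, where `K` is
the range of `W + 1`. As `2 x = (W x + x) - (W x - x)` and `2 W x = (W x + x) + (W x - x)`,
the subspaces `M` and `N` are the graphs of `-T` and `T` in `X = K ⊕ Kᗮ`.

The operator in position `p'` is read off `X = M ⊕ Mᗮ`: there `Mᗮ ⊓ N = ⊥` says that `N` is
the graph of an operator from `M` to `Mᗮ`, and `M ⊓ Nᗮ = ⊥` that its domain is dense.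

To treat real and complex scalars at once, positive square roots are obtained from the power series
of `1 - √(1 - z)`, whose coefficients are the rescaled Catalan numbers. -/

section SquareRoot

open Finset

/-- The coefficients of the power series `1 - √(1 - z) = ∑ n, sqrtCoeff n * z ^ (n + 1)`. -/
noncomputable def sqrtCoeff (n : ℕ) : ℝ :=
  catalan n / (2 * 4 ^ n)

theorem sqrtCoeff_nonneg (n : ℕ) : 0 ≤ sqrtCoeff n := by
  unfold sqrtCoeff
  positivity

theorem sqrtCoeff_zero : 2 * sqrtCoeff 0 = 1 := by
  norm_num [sqrtCoeff]

theorem sum_antidiagonal_sqrtCoeff (n : ℕ) :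
    ∑ ij ∈ antidiagonal n, sqrtCoeff ij.1 * sqrtCoeff ij.2 = 2 * sqrtCoeff (n + 1) := by
  have hterm : ∀ ij ∈ antidiagonal n, sqrtCoeff ij.1 * sqrtCoeff ij.2 =
      (catalan ij.1 * catalan ij.2 : ℝ) / (4 * 4 ^ n) := by
    intro ij hij
    rw [← mem_antidiagonal.1 hij, sqrtCoeff, sqrtCoeff, pow_add]
    ring
  rw [sum_congr rfl hterm, ← sum_div, sqrtCoeff, catalan_succ']
  push_cast
  ring

theorem sum_range_sqrtCoeff (n : ℕ) :
    ∑ k ∈ range n, sqrtCoeff k = 1 - (n.centralBinom : ℝ) / 4 ^ n := by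
  induction n with
  | zero => simp
  | succ n ih =>
    have hcatalan : ((n : ℝ) + 1) * catalan n = n.centralBinom :=
      mod_cast succ_mul_catalan_eq_centralBinom n
    have hcentral : ((n : ℝ) + 1) * (n + 1).centralBinom = 2 * (2 * n + 1) * n.centralBinom :=
      mod_cast n.succ_mul_centralBinom_succ
    have hstep : ((n + 1).centralBinom : ℝ) = 4 * n.centralBinom - 2 * catalan n := by
      refine mul_left_cancel₀ n.cast_add_one_ne_zero (a := (n : ℝ) + 1) ?_
      linear_combination hcentral + 2 * hcatalan
    rw [sum_range_succ, ih, hstep, sqrtCoeff]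
    field_simp
    ring

theorem sum_range_sqrtCoeff_le_one (n : ℕ) : ∑ k ∈ range n, sqrtCoeff k ≤ 1 := by
  rw [sum_range_sqrtCoeff]
  exact sub_le_self _ (by positivity)

variable {𝕜 R : Type*} [RCLike 𝕜] [NormedRing R] [NormedAlgebra 𝕜 R]

variable (𝕜) in
/-- The element `1 - √(1 - c)` of a Banach algebra, for `‖c‖ ≤ 1`, as the sum of its power series
(which takes the junk value `0` where it diverges). -/
noncomputable def oneSubSqrt (c : R) : R :=
  ∑' n, (sqrtCoeff n : 𝕜) • c ^ (n + 1)

theorem norm_sqrtCoeff_smul_pow_le {c : R} (hc : ‖c‖ ≤ 1) (n : ℕ) :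
    ‖(sqrtCoeff n : 𝕜) • c ^ (n + 1)‖ ≤ sqrtCoeff n := by
  rw [norm_smul, RCLike.norm_of_nonneg (sqrtCoeff_nonneg n)]
  exact mul_le_of_le_one_right (sqrtCoeff_nonneg n)
    ((norm_pow_le' c n.succ_pos).trans (pow_le_one₀ (norm_nonneg c) hc))

theorem summable_sqrtCoeff : Summable sqrtCoeff :=
  summable_of_sum_range_le sqrtCoeff_nonneg sum_range_sqrtCoeff_le_one

theorem summable_norm_sqrtCoeff_smul_pow {c : R} (hc : ‖c‖ ≤ 1) :
    Summable fun n => ‖(sqrtCoeff n : 𝕜) • c ^ (n + 1)‖ :=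
  .of_nonneg_of_le (fun _ => norm_nonneg _) (norm_sqrtCoeff_smul_pow_le hc) summable_sqrtCoeff

theorem norm_oneSubSqrt_le_one {c : R} (hc : ‖c‖ ≤ 1) : ‖oneSubSqrt 𝕜 c‖ ≤ 1 :=
  (tsum_of_norm_bounded summable_sqrtCoeff.hasSum (norm_sqrtCoeff_smul_pow_le hc)).trans
    (summable_sqrtCoeff.tsum_le_of_sum_range_le sum_range_sqrtCoeff_le_one)

theorem oneSubSqrt_mul_self [CompleteSpace R] {c : R} (hc : ‖c‖ ≤ 1) :
    oneSubSqrt 𝕜 c * oneSubSqrt 𝕜 c = 2 * oneSubSqrt 𝕜 c - c := by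
  have hsum := summable_norm_sqrtCoeff_smul_pow (𝕜 := 𝕜) hc
  have hcauchy (n : ℕ) : ∑ ij ∈ antidiagonal n,
      ((sqrtCoeff ij.1 : 𝕜) • c ^ (ij.1 + 1)) * ((sqrtCoeff ij.2 : 𝕜) • c ^ (ij.2 + 1)) =
      (2 : 𝕜) • ((sqrtCoeff (n + 1) : 𝕜) • c ^ (n + 1 + 1)) := by
    have hterm : ∀ ij ∈ antidiagonal n,
        ((sqrtCoeff ij.1 : 𝕜) • c ^ (ij.1 + 1)) * ((sqrtCoeff ij.2 : 𝕜) • c ^ (ij.2 + 1)) =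
        ((sqrtCoeff ij.1 * sqrtCoeff ij.2 : ℝ) : 𝕜) • c ^ (n + 1 + 1) := by
      intro ij hij
      rw [smul_mul_smul_comm, ← pow_add, ← mem_antidiagonal.1 hij, RCLike.ofReal_mul]
      congr 2
      ring
    rw [sum_congr rfl hterm, ← sum_smul, ← RCLike.ofReal_sum, sum_antidiagonal_sqrtCoeff, smul_smul]
    norm_cast
  have hzero : (2 : 𝕜) • ((sqrtCoeff 0 : 𝕜) • c ^ (0 + 1)) = c := by
    rw [smul_smul, zero_add, pow_one]
    convert! one_smul 𝕜 c
    exact mod_cast sqrtCoeff_zero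
  calc oneSubSqrt 𝕜 c * oneSubSqrt 𝕜 c
      = ∑' n, (2 : 𝕜) • ((sqrtCoeff (n + 1) : 𝕜) • c ^ (n + 1 + 1)) := by
        rw [oneSubSqrt, tsum_mul_tsum_eq_tsum_sum_antidiagonal_of_summable_norm hsum hsum]
        exact tsum_congr hcauchy
    _ = (2 : 𝕜) • oneSubSqrt 𝕜 c - c := by
        rw [oneSubSqrt, hsum.of_norm.tsum_eq_zero_add, smul_add, hzero, add_sub_cancel_left,
          tsum_const_smul'']
    _ = 2 * oneSubSqrt 𝕜 c - c := by rw [two_smul, two_mul]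

theorem one_sub_oneSubSqrt_mul_self [CompleteSpace R] {c : R} (hc : ‖c‖ ≤ 1) :
    (1 - oneSubSqrt 𝕜 c) * (1 - oneSubSqrt 𝕜 c) = 1 - c := by
  rw [sub_mul, one_mul, mul_sub, mul_one, oneSubSqrt_mul_self hc, two_mul]
  abel

theorem isSelfAdjoint_oneSubSqrt [StarRing R] [StarModule 𝕜 R] [ContinuousStar R] {c : R}
    (hc : IsSelfAdjoint c) : IsSelfAdjoint (oneSubSqrt 𝕜 c) := by
  rw [IsSelfAdjoint, oneSubSqrt, tsum_star]
  refine tsum_congr fun n => ?_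
  rw [star_smul, (hc.pow _).star_eq, RCLike.star_def, RCLike.conj_ofReal]

variable {E : Type*} [NormedAddCommGroup E] [InnerProductSpace 𝕜 E]

theorem re_inner_map_self_le {A : E →L[𝕜] E} (h : ‖A‖ ≤ 1) (x : E) :
    RCLike.re (inner 𝕜 (A x) x) ≤ ‖x‖ ^ 2 := calc
  RCLike.re (inner 𝕜 (A x) x) ≤ ‖A x‖ * ‖x‖ := re_inner_le_norm _ _
  _ ≤ ‖x‖ * ‖x‖ := by gcongr; exact (A.le_of_opNorm_le h x).trans_eq (one_mul _)
  _ = ‖x‖ ^ 2 := (sq _).symm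

theorem re_inner_one_sub_apply_self (A : E →L[𝕜] E) (x : E) :
    RCLike.re (inner 𝕜 ((1 - A) x) x) = ‖x‖ ^ 2 - RCLike.re (inner 𝕜 (A x) x) := by
  change RCLike.re (inner 𝕜 (x - A x) x) = _
  rw [inner_sub_left, map_sub, inner_self_eq_norm_sq]

theorem isPositive_one_sub {A : E →L[𝕜] E} (hA : A.IsSymmetric) (h : ‖A‖ ≤ 1) :
    (1 - A).IsPositive := by
  refine ⟨LinearMap.IsSymmetric.id.sub hA, fun x => ?_⟩
  exact (re_inner_one_sub_apply_self A x).ge.trans' (sub_nonneg.2 (re_inner_map_self_le h x))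

theorem norm_one_sub_le_one_of_isPositive {A : E →L[𝕜] E} (hA : A.IsPositive) (h : ‖A‖ ≤ 1) :
    ‖1 - A‖ ≤ 1 := by
  have hsymm : (1 - A : E →L[𝕜] E).IsSymmetric := LinearMap.IsSymmetric.id.sub hA.isSymmetric
  rw [(1 - A).norm_eq_iSup_rayleighQuotient hsymm]
  refine Real.iSup_le (fun x => ?_) zero_le_one
  have hnonneg : 0 ≤ (1 - A).reApplyInnerSelf x :=
    (isPositive_one_sub hA.isSymmetric h).re_inner_nonneg_left x
  have hle : (1 - A).reApplyInnerSelf x ≤ ‖x‖ ^ 2 :=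
    (re_inner_one_sub_apply_self A x).trans_le (sub_le_self _ (hA.re_inner_nonneg_left x))
  rw [ContinuousLinearMap.rayleighQuotient, abs_of_nonneg (by positivity)]
  exact div_le_one_of_le₀ hle (sq_nonneg _)

theorem exists_isPositive_mul_self_eq_of_norm_le_one [CompleteSpace E] {A : E →L[𝕜] E}
    (hA : A.IsPositive) (h : ‖A‖ ≤ 1) : ∃ S : E →L[𝕜] E, S.IsPositive ∧ S * S = A := by
  have hnorm : ‖1 - A‖ ≤ 1 := norm_one_sub_le_one_of_isPositive hA h
  have hself : IsSelfAdjoint (1 - A) := (IsSelfAdjoint.one _).sub hA.isSelfAdjoint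
  have hpos : (1 - oneSubSqrt 𝕜 (1 - A)).IsPositive :=
    isPositive_one_sub (isSelfAdjoint_oneSubSqrt hself).isSymmetric (norm_oneSubSqrt_le_one hnorm)
  refine ⟨1 - oneSubSqrt 𝕜 (1 - A), hpos, ?_⟩
  rw [one_sub_oneSubSqrt_mul_self hnorm, sub_sub_cancel]

open scoped ComplexOrder in
theorem exists_isPositive_mul_self_eq [CompleteSpace E] {A : E →L[𝕜] E} (hA : A.IsPositive) :
    ∃ S : E →L[𝕜] E, S.IsPositive ∧ S * S = A := by
  obtain rfl | hA0 := eq_or_ne A 0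
  · exact ⟨0, ContinuousLinearMap.isPositive_zero, mul_zero 0⟩
  have hpos : 0 < ‖A‖ := norm_pos_iff.2 hA0
  have hinv : (0 : 𝕜) ≤ (‖A‖⁻¹ : ℝ) := RCLike.ofReal_nonneg.2 (by positivity)
  have hsqrt : (0 : 𝕜) ≤ (√‖A‖ : ℝ) := RCLike.ofReal_nonneg.2 (by positivity)
  have hnorm : ‖((‖A‖⁻¹ : ℝ) : 𝕜) • A‖ ≤ 1 := by
    rw [norm_smul, RCLike.norm_of_nonneg (by positivity), inv_mul_cancel₀ hpos.ne']
  obtain ⟨S, hS, hSS⟩ := exists_isPositive_mul_self_eq_of_norm_le_one (hA.smul_of_nonneg hinv) hnorm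
  refine ⟨((√‖A‖ : ℝ) : 𝕜) • S, hS.smul_of_nonneg hsqrt, ?_⟩
  rw [smul_mul_smul_comm, hSS, smul_smul, ← RCLike.ofReal_mul, ← RCLike.ofReal_mul,
    Real.mul_self_sqrt hpos.le, mul_inv_cancel₀ hpos.ne', RCLike.ofReal_one, one_smul]

end SquareRoot

section HilbertDimension

variable {𝕜 : Type*} [RCLike 𝕜] {E F : Type u} [NormedAddCommGroup E] [InnerProductSpace 𝕜 E]
  [NormedAddCommGroup F] [InnerProductSpace 𝕜 F]

theorem hilbertDim_congr (U : E ≃ₗᵢ[𝕜] F) : hilbertDim 𝕜 E = hilbertDim 𝕜 F := by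
  refine congrArg sInf (Set.ext fun c => exists_congr fun ι => and_congr_left' ?_)
  exact ⟨fun ⟨b⟩ => ⟨.ofRepr (U.symm.trans b.repr)⟩, fun ⟨b⟩ => ⟨.ofRepr (U.trans b.repr)⟩⟩

theorem nonempty_linearIsometryEquiv_of_hilbertDim_eq [CompleteSpace E] [CompleteSpace F]
    (h : hilbertDim 𝕜 E = hilbertDim 𝕜 F) : Nonempty (E ≃ₗᵢ[𝕜] F) := by
  obtain ⟨s, b, -⟩ := exists_hilbertBasis 𝕜 E
  obtain ⟨t, c, -⟩ := exists_hilbertBasis 𝕜 F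
  rw [hilbertDim_eq_mk b, hilbertDim_eq_mk c] at h
  obtain ⟨e⟩ := Cardinal.eq.1 h
  let c' : HilbertBasis s 𝕜 F := .mk (c.orthonormal.comp e e.injective) <| by
    rw [Set.range_comp, e.range_eq_univ, Set.image_univ, c.dense_span]
  exact ⟨b.repr.trans c'.repr.symm⟩

theorem hilbertDim_map (f : E →ₗᵢ[𝕜] F) (K : Submodule 𝕜 E) :
    hilbertDim 𝕜 (K.map f.toLinearMap) = hilbertDim 𝕜 K :=
  (hilbertDim_congr ⟨K.equivMapOfInjective f.toLinearMap f.injective, fun x => f.norm_map x⟩).symm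

end HilbertDimension

section PolarDecomposition

variable {𝕜 : Type*} [RCLike 𝕜]

open ContinuousLinearMap

section Extension

variable {E F G : Type*} [NormedAddCommGroup E] [InnerProductSpace 𝕜 E] [CompleteSpace E]
  [NormedAddCommGroup F] [InnerProductSpace 𝕜 F] [CompleteSpace F]
  [NormedAddCommGroup G] [InnerProductSpace 𝕜 G] [CompleteSpace G]

theorem denseRange_coprod_ker_adjoint (A : E →L[𝕜] F) :
    DenseRange (A.toLinearMap.coprod A.adjoint.ker.subtype) := by
  have hrange : (A.toLinearMap.coprod A.adjoint.ker.subtype).range = A.range ⊔ A.rangeᗮ := by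
    rw [LinearMap.range_coprod, Submodule.range_subtype, orthogonal_range]
  have hdense : Dense ((A.range ⊔ A.rangeᗮ : Submodule 𝕜 F) : Set F) := by
    rw [Submodule.dense_iff_topologicalClosure_eq_top, Submodule.topologicalClosure_eq_top_iff,
      ← Submodule.inf_orthogonal, Submodule.inf_orthogonal_eq_bot]
  rwa [← hrange, LinearMap.coe_range] at hdense

theorem norm_apply_add_ker_adjoint_mul_self (A : E →L[𝕜] F) (x : E) (k : A.adjoint.ker) :
    ‖A x + k‖ * ‖A x + k‖ = ‖A x‖ * ‖A x‖ + ‖k‖ * ‖k‖ := by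
  have hk : (k : F) ∈ A.rangeᗮ := by
    rw [orthogonal_range]
    exact k.2
  exact norm_add_sq_eq_norm_sq_add_norm_sq_of_inner_eq_zero _ _ (hk _ ⟨x, rfl⟩)

theorem exists_linearIsometryEquiv_apply_eq {A : E →L[𝕜] F} {B : E →L[𝕜] G}
    (h : ∀ x, ‖A x‖ = ‖B x‖) (V : A.adjoint.ker ≃ₗᵢ[𝕜] B.adjoint.ker) :
    ∃ W : F ≃ₗᵢ[𝕜] G, ∀ x, W (A x) = B x := by
  let e := (LinearEquiv.refl 𝕜 E).prodCongr V.toLinearEquiv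
  have hnorm (z : E × A.adjoint.ker) : ‖B.toLinearMap.coprod B.adjoint.ker.subtype (e z)‖ =
      ‖A.toLinearMap.coprod A.adjoint.ker.subtype z‖ := by
    change ‖B z.1 + V z.2‖ = ‖A z.1 + z.2‖
    rw [← mul_self_inj_of_nonneg (norm_nonneg _) (norm_nonneg _),
      norm_apply_add_ker_adjoint_mul_self, norm_apply_add_ker_adjoint_mul_self, V.norm_map, h]
  refine ⟨e.extendOfIsometry _ _ (denseRange_coprod_ker_adjoint A)
    (denseRange_coprod_ker_adjoint B) hnorm, fun x => ?_⟩
  simpa [e] using e.extendOfIsometry_eq _ _ (denseRange_coprod_ker_adjoint A)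
    (denseRange_coprod_ker_adjoint B) hnorm (x, 0)

theorem exists_isPositive_norm_apply_eq (B : E →L[𝕜] F) :
    ∃ S : E →L[𝕜] E, S.IsPositive ∧ ∀ x, ‖S x‖ = ‖B x‖ := by
  obtain ⟨S, hS, hSS⟩ := exists_isPositive_mul_self_eq (isPositive_adjoint_comp_self B)
  have hadj : S.adjoint ∘L S = B.adjoint ∘L B := by
    rwa [hS.isSelfAdjoint.adjoint_eq]
  refine ⟨S, hS, fun x => (sq_eq_sq₀ (norm_nonneg _) (norm_nonneg _)).1 ?_⟩
  rw [apply_norm_sq_eq_inner_adjoint_left, hadj, ← apply_norm_sq_eq_inner_adjoint_left]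

end Extension

theorem exists_unitary_polar_decomposition {E F : Type u} [NormedAddCommGroup E]
    [InnerProductSpace 𝕜 E] [CompleteSpace E] [NormedAddCommGroup F] [InnerProductSpace 𝕜 F]
    [CompleteSpace F] {B : E →L[𝕜] F} (h : hilbertDim 𝕜 B.ker = hilbertDim 𝕜 B.adjoint.ker) :
    ∃ (W : E ≃ₗᵢ[𝕜] F) (S : E →L[𝕜] E), S.IsPositive ∧ ∀ x, W (S x) = B x := by
  obtain ⟨S, hS, hSB⟩ := exists_isPositive_norm_apply_eq B
  have hker : S.adjoint.ker = B.ker := by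
    ext x
    rw [hS.isSelfAdjoint.adjoint_eq, LinearMap.mem_ker, LinearMap.mem_ker, ← norm_eq_zero,
      ← norm_eq_zero (a := B.toLinearMap x)]
    exact (hSB x).congr_left
  rw [← hker] at h
  have : CompleteSpace S.adjoint.ker := S.adjoint.isClosed_ker.completeSpace_coe
  have : CompleteSpace B.adjoint.ker := B.adjoint.isClosed_ker.completeSpace_coe
  obtain ⟨V⟩ := nonempty_linearIsometryEquiv_of_hilbertDim_eq h
  obtain ⟨W, hW⟩ := exists_linearIsometryEquiv_apply_eq hSB V
  exact ⟨W, S, hS, hW⟩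

end PolarDecomposition

section Contraction

variable {𝕜 : Type*} [RCLike 𝕜]

open ContinuousLinearMap Submodule

theorem UnitarilyEquivalentPairs.of_map_eq {X X' : Type*} [NormedAddCommGroup X]
    [InnerProductSpace 𝕜 X] [NormedAddCommGroup X'] [InnerProductSpace 𝕜 X'] {M N : Submodule 𝕜 X}
    {M' N' : Submodule 𝕜 X'} (U : X ≃ₗᵢ[𝕜] X') (hM : M.map U.toLinearEquiv.toLinearMap = M')
    (hN : N.map U.toLinearEquiv.toLinearMap = N') : UnitarilyEquivalentPairs M N M' N' :=
  ⟨U, .inl ⟨hM, hN⟩⟩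

section

variable {X F G : Type*} [NormedAddCommGroup X] [InnerProductSpace 𝕜 X] [NormedAddCommGroup F]
  [InnerProductSpace 𝕜 F] [NormedAddCommGroup G] [InnerProductSpace 𝕜 G]

theorem map_orthogonalDecomposition_eq_hilbertGraph (K : Submodule 𝕜 X) [K.HasOrthogonalProjection]
    (T : K →L[𝕜] Kᗮ) :
    (K.subtypeL + Kᗮ.subtypeL ∘L T).range.map K.orthogonalDecomposition.toLinearEquiv.toLinearMap =
      T.hilbertGraph := by
  ext w
  have hgraph (k : K) : (k : X) + T k = K.orthogonalDecomposition.symm w ↔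
      WithLp.toLp 2 (k, T k) = w :=
    K.orthogonalDecomposition.symm.injective.eq_iff
      (a := WithLp.toLp 2 (k, T k))
  calc w ∈ (K.subtypeL + Kᗮ.subtypeL ∘L T).range.map _
      ↔ ∃ k : K, (k : X) + T k = K.orthogonalDecomposition.symm w := mem_map_equiv _
    _ ↔ ∃ k : K, WithLp.toLp 2 (k, T k) = w := exists_congr hgraph
    _ ↔ T w.fst = w.snd := ⟨by rintro ⟨k, rfl⟩; rfl, fun h => ⟨w.fst, by rw [h]; rfl⟩⟩
    _ ↔ w ∈ T.hilbertGraph := eq_comm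

theorem exists_norm_le_one_apply_eq [CompleteSpace F] {f : G →L[𝕜] X} {g : G →L[𝕜] F}
    (hle : ∀ x, ‖g x‖ ≤ ‖f x‖) :
    ∃ T : f.range →L[𝕜] F, ‖T‖ ≤ 1 ∧ ∀ x, T (f.rangeRestrict x) = g x := by
  have hdense : DenseRange f.toLinearMap.rangeRestrict :=
    f.toLinearMap.surjective_rangeRestrict.denseRange
  have hle' : ∀ x, ‖g.toLinearMap x‖ ≤ 1 * ‖f.toLinearMap.rangeRestrict x‖ := fun x =>
    (hle x).trans_eq (one_mul _).symm
  exact ⟨g.toLinearMap.extendOfNorm f.toLinearMap.rangeRestrict,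
    LinearMap.opNorm_extendOfNorm_le hdense zero_le_one hle',
    fun x => LinearMap.extendOfNorm_eq hdense ⟨1, hle'⟩ x⟩

theorem exists_contraction_of_orthogonal_ranges [CompleteSpace X] {f g : G →L[𝕜] X}
    [CompleteSpace f.range]
    (horth : ∀ x y, inner 𝕜 (f x) (g y) = 0) (hle : ∀ x, ‖g x‖ ≤ ‖f x‖) :
    ∃ T : f.range →L[𝕜] f.rangeᗮ, ‖T‖ ≤ 1 ∧
      UnitarilyEquivalentPairs (f - g).range (f + g).range (-T).hilbertGraph T.hilbertGraph := by
  have hmem (y : G) : g y ∈ f.rangeᗮ := by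
    rintro _ ⟨x, rfl⟩
    exact horth x y
  obtain ⟨T, hT, hTf⟩ := exists_norm_le_one_apply_eq (g := g.codRestrict f.rangeᗮ hmem) hle
  have hsub : (f - g).range = (f.range.subtypeL + f.rangeᗮ.subtypeL ∘L (-T)).range := by
    rw [← LinearMap.range_comp_of_range_eq_top _ f.toLinearMap.range_rangeRestrict]
    congr 1
    ext x
    change f x - g x = f x + (-T (f.rangeRestrict x) : f.rangeᗮ)
    rw [hTf]
    exact sub_eq_add_neg _ _
  have hadd : (f + g).range = (f.range.subtypeL + f.rangeᗮ.subtypeL ∘L T).range := by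
    rw [← LinearMap.range_comp_of_range_eq_top _ f.toLinearMap.range_rangeRestrict]
    congr 1
    ext x
    change f x + g x = f x + (T (f.rangeRestrict x) : f.rangeᗮ)
    rw [hTf]
    rfl
  refine ⟨T, hT, .of_map_eq f.range.orthogonalDecomposition ?_ ?_⟩
  · rw [hsub, map_orthogonalDecomposition_eq_hilbertGraph]
  · rw [hadd, map_orthogonalDecomposition_eq_hilbertGraph]

theorem norm_sub_le_norm_add_of_re_inner_nonneg {u v : X} (h : 0 ≤ RCLike.re (inner 𝕜 u v)) :
    ‖u - v‖ ≤ ‖u + v‖ := by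
  refine le_of_sq_le_sq ?_ (norm_nonneg _)
  rw [@norm_sub_sq 𝕜, @norm_add_sq 𝕜]
  linarith

theorem norm_right_le_norm_add_of_re_inner_nonneg {u v : X}
    (h : 0 ≤ RCLike.re (inner 𝕜 u v)) : ‖v‖ ≤ ‖u + v‖ := by
  refine le_of_sq_le_sq ?_ (norm_nonneg _)
  rw [@norm_add_sq 𝕜]
  linarith [sq_nonneg ‖u‖]

theorem exists_contraction_of_linearIsometry [CompleteSpace X] [CompleteSpace G] {φ ψ : G →ₗᵢ[𝕜] X}
    (hsymm : ∀ x y, inner 𝕜 (ψ x) (φ y) = inner 𝕜 (φ x) (ψ y))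
    (hpos : ∀ x, 0 ≤ RCLike.re (inner 𝕜 (ψ x) (φ x))) :
    ∃ (K : Submodule 𝕜 X) (_ : CompleteSpace K) (T : K →L[𝕜] Kᗮ), ‖T‖ ≤ 1 ∧
      UnitarilyEquivalentPairs φ.range ψ.range (-T).hilbertGraph T.hilbertGraph := by
  let f : G →L[𝕜] X := ψ.toContinuousLinearMap + φ.toContinuousLinearMap
  let g : G →L[𝕜] X := ψ.toContinuousLinearMap - φ.toContinuousLinearMap
  have horth (x y : G) : inner 𝕜 (f x) (g y) = 0 := by
    change inner 𝕜 (ψ x + φ x) (ψ y - φ y) = 0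
    rw [inner_add_left, inner_sub_right, inner_sub_right, ψ.inner_map_map, φ.inner_map_map, hsymm]
    ring
  have hle (x : G) : ‖g x‖ ≤ ‖f x‖ := norm_sub_le_norm_add_of_re_inner_nonneg (hpos x)
  have hanti : AntilipschitzWith 1 f := f.antilipschitz_of_bound fun x => by
    rw [NNReal.coe_one, one_mul, ← φ.norm_map]
    exact norm_right_le_norm_add_of_re_inner_nonneg (hpos x)
  have : CompleteSpace f.range := (hanti.isClosed_range f.uniformContinuous).completeSpace_coe
  have hsub : (f - g).range = φ.range := by
    have : f - g = (2 : 𝕜) • φ.toContinuousLinearMap := by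
      simp only [f, g]
      module
    rw [this]
    exact LinearMap.range_smul φ.toLinearMap 2 two_ne_zero
  have hadd : (f + g).range = ψ.range := by
    have : f + g = (2 : 𝕜) • ψ.toContinuousLinearMap := by
      simp only [f, g]
      module
    rw [this]
    exact LinearMap.range_smul ψ.toLinearMap 2 two_ne_zero
  obtain ⟨T, hT, hU⟩ := exists_contraction_of_orthogonal_ranges horth hle
  rw [hsub, hadd] at hU
  exact ⟨f.range, inferInstance, T, hT, hU⟩

end

variable {X : Type u} [NormedAddCommGroup X] [InnerProductSpace 𝕜 X] {M N : Submodule 𝕜 X}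

theorem hilbertDim_ker_orthogonalProjectionOnto_comp_subtypeL (M N : Submodule 𝕜 X)
    [N.HasOrthogonalProjection] :
    hilbertDim 𝕜 (N.orthogonalProjectionOnto ∘L M.subtypeL).ker = hilbertDim 𝕜 ↥(M ⊓ Nᗮ) := by
  rw [← map_comap_subtype, ← N.ker_orthogonalProjectionOnto]
  exact (hilbertDim_map M.subtypeₗᵢ _).symm

variable [CompleteSpace X]

theorem EquivalentlyPositioned.exists_linearIsometryEquiv [CompleteSpace M] [CompleteSpace N]
    (h : EquivalentlyPositioned M N) :
    ∃ W : M ≃ₗᵢ[𝕜] N, (∀ x y : M, inner 𝕜 (W x : X) (y : X) = inner 𝕜 (x : X) (W y : X)) ∧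
      ∀ x : M, 0 ≤ RCLike.re (inner 𝕜 (W x : X) (x : X)) := by
  let B : M →L[𝕜] N := N.orthogonalProjectionOnto ∘L M.subtypeL
  have hB : B.adjoint = M.orthogonalProjectionOnto ∘L N.subtypeL := by
    rw [adjoint_comp, adjoint_subtypeL, adjoint_orthogonalProjectionOnto]
  have hdim : hilbertDim 𝕜 B.ker = hilbertDim 𝕜 B.adjoint.ker := by
    rw [hB, hilbertDim_ker_orthogonalProjectionOnto_comp_subtypeL,
      hilbertDim_ker_orthogonalProjectionOnto_comp_subtypeL, h, inf_comm]
  obtain ⟨W, S, hS, hWS⟩ := exists_unitary_polar_decomposition hdim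
  have hW (x y : M) : inner 𝕜 (W x : X) (y : X) = inner 𝕜 x (S y) := calc
    inner 𝕜 (W x : X) (y : X) = inner 𝕜 (W x) (B y) :=
      (inner_orthogonalProjectionOnto_eq_of_mem_left (W x) (y : X)).symm
    _ = inner 𝕜 x (S y) := by rw [← hWS, W.inner_map_map]
  refine ⟨W, fun x y => ?_, fun x => ?_⟩
  · rw [hW, ← hS.inner_left_eq_inner_right, ← inner_conj_symm, ← hW, inner_conj_symm]
  · rw [hW]
    exact hS.re_inner_nonneg_right x

theorem EquivalentlyPositioned.exists_contraction (hM : IsClosed (M : Set X))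
    (hN : IsClosed (N : Set X)) (h : EquivalentlyPositioned M N) :
    ∃ (K : Submodule 𝕜 X) (_ : CompleteSpace K) (T : K →L[𝕜] Kᗮ), ‖T‖ ≤ 1 ∧
      UnitarilyEquivalentPairs M N (-T).hilbertGraph T.hilbertGraph := by
  have : CompleteSpace M := hM.completeSpace_coe
  have : CompleteSpace N := hN.completeSpace_coe
  obtain ⟨W, hsymm, hpos⟩ := h.exists_linearIsometryEquiv
  have hrangeM : M.subtypeₗᵢ.range = M := M.range_subtype
  have hrangeN : (N.subtypeₗᵢ.comp W.toLinearIsometry).range = N := by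
    change (N.subtype ∘ₗ W.toLinearEquiv.toLinearMap).range = N
    rw [LinearMap.range_comp_of_range_eq_top _ W.toLinearEquiv.range, N.range_subtype]
  have hexists := exists_contraction_of_linearIsometry (φ := M.subtypeₗᵢ)
    (ψ := N.subtypeₗᵢ.comp W.toLinearIsometry) hsymm hpos
  rwa [hrangeM, hrangeN] at hexists

end Contraction

section UnitaryInvariance

variable {𝕜 : Type*} [RCLike 𝕜]

theorem inPositionPPrime_comm {X : Type*} [NormedAddCommGroup X] [InnerProductSpace 𝕜 X]
    {M N : Submodule 𝕜 X} : InPositionPPrime M N ↔ InPositionPPrime N M := by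
  rw [InPositionPPrime, InPositionPPrime, inf_comm M, inf_comm N, and_comm]

theorem equivalentlyPositioned_comm {X : Type u} [NormedAddCommGroup X] [InnerProductSpace 𝕜 X]
    {M N : Submodule 𝕜 X} : EquivalentlyPositioned M N ↔ EquivalentlyPositioned N M := by
  rw [EquivalentlyPositioned, EquivalentlyPositioned, inf_comm M, inf_comm N, eq_comm]

theorem InPositionPPrime.equivalentlyPositioned {X : Type u} [NormedAddCommGroup X]
    [InnerProductSpace 𝕜 X] {M N : Submodule 𝕜 X} (h : InPositionPPrime M N) :
    EquivalentlyPositioned M N := by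
  rw [EquivalentlyPositioned, h.1, h.2]

theorem map_inf_orthogonal {X X' : Type*} [NormedAddCommGroup X] [InnerProductSpace 𝕜 X]
    [NormedAddCommGroup X'] [InnerProductSpace 𝕜 X'] (U : X ≃ₗᵢ[𝕜] X') (K L : Submodule 𝕜 X) :
    (K ⊓ Lᗮ).map U.toLinearEquiv.toLinearMap =
      K.map U.toLinearEquiv.toLinearMap ⊓ (L.map U.toLinearEquiv.toLinearMap)ᗮ := by
  rw [Submodule.map_inf _ U.injective]
  exact congrArg _ (Submodule.map_orthogonal_equiv L U)

theorem inPositionPPrime_map_iff {X X' : Type*} [NormedAddCommGroup X] [InnerProductSpace 𝕜 X]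
    [NormedAddCommGroup X'] [InnerProductSpace 𝕜 X'] (U : X ≃ₗᵢ[𝕜] X') {M N : Submodule 𝕜 X} :
    InPositionPPrime (M.map U.toLinearEquiv.toLinearMap) (N.map U.toLinearEquiv.toLinearMap) ↔
      InPositionPPrime M N := by
  have hbot (K : Submodule 𝕜 X) : K.map U.toLinearEquiv.toLinearMap = ⊥ ↔ K = ⊥ :=
    Submodule.map_eq_bot_iff (e := U.toLinearEquiv)
  rw [InPositionPPrime, InPositionPPrime, inf_comm (M.map _)ᗮ, inf_comm Mᗮ,
    ← map_inf_orthogonal, ← map_inf_orthogonal, hbot, hbot]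

theorem equivalentlyPositioned_map_iff {X X' : Type u} [NormedAddCommGroup X]
    [InnerProductSpace 𝕜 X] [NormedAddCommGroup X'] [InnerProductSpace 𝕜 X'] (U : X ≃ₗᵢ[𝕜] X')
    {M N : Submodule 𝕜 X} :
    EquivalentlyPositioned (M.map U.toLinearEquiv.toLinearMap)
      (N.map U.toLinearEquiv.toLinearMap) ↔ EquivalentlyPositioned M N := by
  have hdim (K : Submodule 𝕜 X) :
      hilbertDim 𝕜 (K.map U.toLinearEquiv.toLinearMap) = hilbertDim 𝕜 K :=
    hilbertDim_map U.toLinearIsometry K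
  rw [EquivalentlyPositioned, EquivalentlyPositioned, inf_comm (M.map _)ᗮ, inf_comm Mᗮ,
    ← map_inf_orthogonal, ← map_inf_orthogonal, hdim, hdim]

theorem UnitarilyEquivalentPairs.inPositionPPrime_iff {X X' : Type*} [NormedAddCommGroup X]
    [InnerProductSpace 𝕜 X] [NormedAddCommGroup X'] [InnerProductSpace 𝕜 X']
    {M N : Submodule 𝕜 X} {M' N' : Submodule 𝕜 X'} (h : UnitarilyEquivalentPairs M N M' N') :
    InPositionPPrime M N ↔ InPositionPPrime M' N' := by
  obtain ⟨U, ⟨rfl, rfl⟩ | ⟨rfl, rfl⟩⟩ := h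
  · exact (inPositionPPrime_map_iff U).symm
  · exact inPositionPPrime_comm.trans (inPositionPPrime_map_iff U).symm

theorem UnitarilyEquivalentPairs.equivalentlyPositioned_iff {X X' : Type u}
    [NormedAddCommGroup X] [InnerProductSpace 𝕜 X] [NormedAddCommGroup X']
    [InnerProductSpace 𝕜 X'] {M N : Submodule 𝕜 X} {M' N' : Submodule 𝕜 X'}
    (h : UnitarilyEquivalentPairs M N M' N') :
    EquivalentlyPositioned M N ↔ EquivalentlyPositioned M' N' := by
  obtain ⟨U, ⟨rfl, rfl⟩ | ⟨rfl, rfl⟩⟩ := h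
  · exact (equivalentlyPositioned_map_iff U).symm
  · exact equivalentlyPositioned_comm.trans (equivalentlyPositioned_map_iff U).symm

end UnitaryInvariance

section Graphs

variable {𝕜 : Type*} [RCLike 𝕜]

open ContinuousLinearMap

theorem map_hilbertGraph_withLpProdCongr_neg {E F : Type*} [NormedAddCommGroup E]
    [InnerProductSpace 𝕜 E] [NormedAddCommGroup F] [InnerProductSpace 𝕜 F] (T : E →L[𝕜] F) :
    T.hilbertGraph.map (LinearIsometryEquiv.withLpProdCongr 2 (.refl 𝕜 E)
      (.neg 𝕜)).toLinearEquiv.toLinearMap = (-T).hilbertGraph := by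
  ext w
  exact (Submodule.mem_map_equiv _).trans neg_eq_iff_eq_neg

theorem equivalentlyPositioned_hilbertGraph {E F : Type u} [NormedAddCommGroup E]
    [InnerProductSpace 𝕜 E] [NormedAddCommGroup F] [InnerProductSpace 𝕜 F] (T : E →L[𝕜] F) :
    EquivalentlyPositioned (-T).hilbertGraph T.hilbertGraph := by
  let D : WithLp 2 (E × F) ≃ₗᵢ[𝕜] WithLp 2 (E × F) := .withLpProdCongr 2 (.refl 𝕜 E) (.neg 𝕜)
  have hD : ((-T).hilbertGraph ⊓ T.hilbertGraphᗮ).map D.toLinearEquiv.toLinearMap =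
      (-T).hilbertGraphᗮ ⊓ T.hilbertGraph := by
    rw [map_inf_orthogonal, map_hilbertGraph_withLpProdCongr_neg,
      map_hilbertGraph_withLpProdCongr_neg, neg_neg, inf_comm]
  rw [EquivalentlyPositioned, ← hD]
  exact (hilbertDim_map D.toLinearIsometry _).symm

variable {E F : Type*} [NormedAddCommGroup E] [InnerProductSpace 𝕜 E] [NormedAddCommGroup F]
  [InnerProductSpace 𝕜 F]

theorem mem_orthogonal_hilbertGraph_iff [CompleteSpace E] [CompleteSpace F] {T : E →L[𝕜] F}
    {w : WithLp 2 (E × F)} : w ∈ T.hilbertGraphᗮ ↔ w.fst + T.adjoint w.snd = 0 := by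
  have hinner (x : E) : inner 𝕜 (WithLp.toLp 2 (x, T x)) w =
      inner 𝕜 x (w.fst + T.adjoint w.snd) := by
    rw [inner_add_right, adjoint_inner_right]
    rfl
  constructor
  · refine fun h => ext_inner_left 𝕜 fun x => ?_
    rw [← hinner, inner_zero_right]
    exact h (WithLp.toLp 2 (x, T x)) rfl
  · rintro h ⟨x, y⟩ (rfl : y = T x)
    rw [hinner, h, inner_zero_right]

theorem hilbertGraph_neg_inf_orthogonal_eq_bot_iff [CompleteSpace E] [CompleteSpace F]
    (T : E →L[𝕜] F) :
    (-T).hilbertGraph ⊓ T.hilbertGraphᗮ = ⊥ ↔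
      Function.Injective (ContinuousLinearMap.id 𝕜 E - T.adjoint ∘L T) := by
  have hmem (x : E) : WithLp.toLp 2 (x, -T x) ∈ T.hilbertGraphᗮ ↔
      (ContinuousLinearMap.id 𝕜 E - T.adjoint ∘L T) x = 0 := by
    rw [mem_orthogonal_hilbertGraph_iff]
    simp [sub_eq_add_neg]
  rw [Submodule.eq_bot_iff, injective_iff_map_eq_zero]
  constructor
  · intro h x hx
    exact congrArg WithLp.fst (h (WithLp.toLp 2 (x, -T x)) ⟨rfl, (hmem x).2 hx⟩)
  · rintro h ⟨x, y⟩ ⟨(rfl : y = -T x), hx⟩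
    rw [h x ((hmem x).1 hx), map_zero, neg_zero]
    rfl

theorem inPositionPPrime_hilbertGraph_iff [CompleteSpace E] [CompleteSpace F] (T : E →L[𝕜] F) :
    InPositionPPrime (-T).hilbertGraph T.hilbertGraph ↔
      Function.Injective (ContinuousLinearMap.id 𝕜 E - T.adjoint ∘L T) := by
  have hneg := hilbertGraph_neg_inf_orthogonal_eq_bot_iff (-T)
  rw [neg_neg, map_neg, neg_comp, comp_neg, neg_neg, inf_comm] at hneg
  rw [InPositionPPrime, hneg, hilbertGraph_neg_inf_orthogonal_eq_bot_iff, and_self_iff]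

theorem inPositionPPrime_prod_top_bot_hilbertGraph {S : E →ₗ.[𝕜] F}
    (hS : Dense (S.domain : Set E)) :
    InPositionPPrime (Submodule.prod (⊤ : Submodule 𝕜 E) (⊥ : Submodule 𝕜 F)).inHilbertSum
      S.hilbertGraph := by
  constructor <;> rw [Submodule.eq_bot_iff]
  · rintro ⟨x, y⟩ ⟨⟨-, (rfl : y = 0)⟩, hxS⟩
    have hx : x = 0 := hS.eq_zero_of_inner_right 𝕜 fun z hz => by
      have hinner : inner 𝕜 z x + inner 𝕜 (S ⟨z, hz⟩) (0 : F) = 0 :=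
        hxS (WithLp.toLp 2 (z, S ⟨z, hz⟩)) (S.mem_graph ⟨z, hz⟩)
      rwa [inner_zero_right, add_zero] at hinner
    rw [hx]
    rfl
  · rintro ⟨x, y⟩ ⟨hxE, hxS⟩
    have hinner : inner 𝕜 x x + inner 𝕜 (0 : F) y = 0 := hxE (WithLp.toLp 2 (x, 0)) ⟨trivial, rfl⟩
    rw [inner_zero_left, add_zero, inner_self_eq_zero] at hinner
    have hy : y = 0 := S.graph_fst_eq_zero_snd hxS hinner
    rw [hinner, hy]
    rfl

end Graphs

section GraphOperator

variable {𝕜 X : Type*} [RCLike 𝕜] [NormedAddCommGroup X] [InnerProductSpace 𝕜 X]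

open Submodule

/-- The operator from `M` to `Mᗮ` whose graph is `N`, seen inside `M ⊕ Mᗮ`. It is meaningful only
if `Mᗮ ⊓ N = ⊥`, as otherwise `N` is not the graph of an operator. -/
noncomputable def graphOperator (M N : Submodule 𝕜 X) : M →ₗ.[𝕜] Mᗮ :=
  (N.comap (M.subtype.coprod Mᗮ.subtype)).toLinearPMap

variable {M N : Submodule 𝕜 X}

theorem graph_graphOperator (h : Mᗮ ⊓ N = ⊥) :
    (graphOperator M N).graph = N.comap (M.subtype.coprod Mᗮ.subtype) := by
  refine toLinearPMap_graph_eq _ ?_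
  rintro ⟨x, y⟩ hxy (rfl : x = 0)
  have hy : (y : X) ∈ Mᗮ ⊓ N := ⟨y.2, by simpa using hxy⟩
  rw [h, mem_bot] at hy
  exact Subtype.ext hy

theorem isClosed_graphOperator (hN : IsClosed (N : Set X)) (h : Mᗮ ⊓ N = ⊥) :
    (graphOperator M N).IsClosed := by
  rw [LinearPMap.IsClosed, graph_graphOperator h]
  exact hN.preimage (by fun_prop : Continuous fun w : M × Mᗮ => (w.1 : X) + w.2)

theorem dense_domain_graphOperator [CompleteSpace M] (h : M ⊓ Nᗮ = ⊥) :
    Dense ((graphOperator M N).domain : Set M) := by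
  have hdomain {n : X} (hn : n ∈ N) :
      M.orthogonalProjectionOnto n ∈ (graphOperator M N).domain := by
    refine ⟨(M.orthogonalProjectionOnto n, Mᗮ.orthogonalProjectionOnto n), ?_, rfl⟩
    change M.starProjection n + Mᗮ.starProjection n ∈ N
    rwa [M.starProjection_add_starProjection_orthogonal]
  rw [dense_iff_topologicalClosure_eq_top, topologicalClosure_eq_top_iff, eq_bot_iff]
  intro y hy
  have hyN : (y : X) ∈ M ⊓ Nᗮ := ⟨y.2, fun n hn => by
    rw [← inner_orthogonalProjectionOnto_eq_of_mem_right]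
    exact hy _ (hdomain hn)⟩
  rw [h, mem_bot] at hyN
  exact Subtype.ext hyN

theorem map_orthogonalDecomposition (M N : Submodule 𝕜 X) [M.HasOrthogonalProjection] :
    N.map M.orthogonalDecomposition.toLinearEquiv.toLinearMap =
      (N.comap (M.subtype.coprod Mᗮ.subtype)).inHilbertSum := by
  ext w
  exact mem_map_equiv _

theorem comap_coprod_subtype_self (M : Submodule 𝕜 X) :
    M.comap (M.subtype.coprod Mᗮ.subtype) = prod ⊤ ⊥ := by
  ext ⟨x, y⟩
  have hy : (y : X) ∈ M ↔ y = 0 :=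
    ⟨fun h => Subtype.ext (M.orthogonal_disjoint.eq_bot.le ⟨h, y.2⟩), fun h => h ▸ M.zero_mem⟩
  calc (x : X) + y ∈ M ↔ y = 0 := (M.add_mem_iff_right x.2).trans hy
    _ ↔ (x, y) ∈ prod ⊤ ⊥ := (and_iff_right trivial).symm

theorem unitarilyEquivalentPairs_hilbertGraph_graphOperator [M.HasOrthogonalProjection]
    (h : Mᗮ ⊓ N = ⊥) :
    UnitarilyEquivalentPairs M N
      (prod (⊤ : Submodule 𝕜 M) (⊥ : Submodule 𝕜 Mᗮ)).inHilbertSum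
      (graphOperator M N).hilbertGraph := by
  refine .of_map_eq M.orthogonalDecomposition ?_ ?_
  · rw [map_orthogonalDecomposition, comap_coprod_subtype_self]
  · rw [map_orthogonalDecomposition, LinearPMap.hilbertGraph, graph_graphOperator h]

end GraphOperator

theorem proposition4p1 {𝕜 : Type*} [RCLike 𝕜] {X : Type u} [NormedAddCommGroup X]
    [InnerProductSpace 𝕜 X] [CompleteSpace X] (M N : Submodule 𝕜 X)
    (hM : IsClosed (M : Set X)) (hN : IsClosed (N : Set X)) :
    ((InPositionPPrime M N ↔
        ∃ (X₁ X₂ : Type u)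
          (_ : NormedAddCommGroup X₁) (_ : InnerProductSpace 𝕜 X₁) (_ : CompleteSpace X₁)
          (_ : NormedAddCommGroup X₂) (_ : InnerProductSpace 𝕜 X₂) (_ : CompleteSpace X₂)
          (T : X₁ →L[𝕜] X₂), ‖T‖ ≤ 1 ∧
            Function.Injective
              (ContinuousLinearMap.id 𝕜 X₁ - ContinuousLinearMap.adjoint T ∘L T) ∧
            UnitarilyEquivalentPairs M N (-T).hilbertGraph T.hilbertGraph) ∧
      (InPositionPPrime M N ↔
        ∃ (Y₁ Y₂ : Type u)
          (_ : NormedAddCommGroup Y₁) (_ : InnerProductSpace 𝕜 Y₁) (_ : CompleteSpace Y₁)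
          (_ : NormedAddCommGroup Y₂) (_ : InnerProductSpace 𝕜 Y₂) (_ : CompleteSpace Y₂)
          (S : Y₁ →ₗ.[𝕜] Y₂), Dense (S.domain : Set Y₁) ∧ S.IsClosed ∧
            UnitarilyEquivalentPairs M N
              (Submodule.prod (⊤ : Submodule 𝕜 Y₁) (⊥ : Submodule 𝕜 Y₂)).inHilbertSum
              S.hilbertGraph)) ∧
    (EquivalentlyPositioned M N ↔
      ∃ (X₁ X₂ : Type u)
        (_ : NormedAddCommGroup X₁) (_ : InnerProductSpace 𝕜 X₁) (_ : CompleteSpace X₁)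
        (_ : NormedAddCommGroup X₂) (_ : InnerProductSpace 𝕜 X₂) (_ : CompleteSpace X₂)
        (T : X₁ →L[𝕜] X₂), ‖T‖ ≤ 1 ∧
          UnitarilyEquivalentPairs M N (-T).hilbertGraph T.hilbertGraph) := by
  refine ⟨⟨⟨fun h => ?_, ?_⟩, ⟨fun h => ?_, ?_⟩⟩, ⟨fun h => ?_, ?_⟩⟩
  · obtain ⟨K, _, T, hT, hU⟩ := h.equivalentlyPositioned.exists_contraction hM hN
    have hinj := (inPositionPPrime_hilbertGraph_iff T).1 (hU.inPositionPPrime_iff.1 h)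
    exact ⟨K, Kᗮ, _, _, inferInstance, _, _, inferInstance, T, hT, hinj, hU⟩
  · rintro ⟨X₁, X₂, _, _, _, _, _, _, T, -, hinj, hU⟩
    exact hU.inPositionPPrime_iff.2 ((inPositionPPrime_hilbertGraph_iff T).2 hinj)
  · have : CompleteSpace M := hM.completeSpace_coe
    exact ⟨M, Mᗮ, _, _, inferInstance, _, _, inferInstance, graphOperator M N,
      dense_domain_graphOperator h.1, isClosed_graphOperator hN h.2,
      unitarilyEquivalentPairs_hilbertGraph_graphOperator h.2⟩
  · rintro ⟨Y₁, Y₂, _, _, _, _, _, _, S, hS, -, hU⟩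
    exact hU.inPositionPPrime_iff.2 (inPositionPPrime_prod_top_bot_hilbertGraph hS)
  · obtain ⟨K, _, T, hT, hU⟩ := h.exists_contraction hM hN
    exact ⟨K, Kᗮ, _, _, inferInstance, _, _, inferInstance, T, hT, hU⟩
  · rintro ⟨X₁, X₂, _, _, _, _, _, _, T, -, hU⟩
    exact hU.equivalentlyPositioned_iff.2 (equivalentlyPositioned_hilbertGraph T)
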